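/- Let $\Gamma$ be a finite multigraph without loops (parallel edges are allowed; $\Gamma$ need not be connected), with $n\ge 1$ vertices numbered $1,\dots,n$ in an arbitrary way. Let $A_\Gamma$ be its adjacency matrix, that is, the $n\times n$ matrix whose $(i,j)$ entry is the number of edges joining vertices $i$ and $j$; let $D_\Gamma$ be the diagonal matrix of vertex degrees; and let the Kirchhoff minor $K_\Gamma$ be the $(n-1)\times(n-1)$ matrix obtained from $D_\Gamma-A_\Gamma$ by deleting the last row and the last column. Let $\tau(\Gamma)$ be the number of spanning trees of $\Gamma$, i.e. of subgraphs of $\Gamma$ that contain all its vertices, are connected and have no cycles (parallel edges are regarded as distinct). Then \[\tau(\Gamma)=\det K_\Gamma ,\] where for $n=1$ the determinant of the empty matrix is $1$. -/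

import Mathlib

namespace Graph

/-- From every vertex one can walk along edges to every other vertex; the graph has a vertex. -/
def IsConnectedGraph {α β : Type*} (G : Graph α β) : Prop :=
  G.vertexSet.Nonempty ∧
    ∀ x ∈ G.vertexSet, ∀ y ∈ G.vertexSet, Relation.ReflTransGen G.Adj x y

/-- `G.IsCycleOn x e` says that `x 0, e 0, x 1, e 1, …, x k, e k, x 0` is a cycle of length `k + 1`:
the vertices are pairwise distinct, the edges are pairwise distinct, and `e i` joins `x i` to its
cyclic successor (addition in `Fin (k + 1)` wraps around). A loop is a cycle of length one, and two
parallel edges form a cycle of length two. -/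
def IsCycleOn {α β : Type*} (G : Graph α β) {k : ℕ}
    (x : Fin (k + 1) → α) (e : Fin (k + 1) → β) : Prop :=
  Function.Injective x ∧ Function.Injective e ∧ ∀ i, G.IsLink (e i) (x i) (x (i + 1))

/-- A tree is a connected graph without cycles. -/
def IsTreeGraph {α β : Type*} (G : Graph α β) : Prop :=
  G.IsConnectedGraph ∧
    ∀ (k : ℕ) (x : Fin (k + 1) → α) (e : Fin (k + 1) → β), ¬ G.IsCycleOn x e

/-- The set of spanning trees of `G`: subgraphs on all the vertices of `G` that are trees. -/
def spanningTrees {α β : Type*} (G : Graph α β) : Set (Graph α β) :=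
  {T | T.IsSpanningSubgraph G ∧ T.IsTreeGraph}

/-- The number of spanning trees (meaningful if the edge set is finite). -/
noncomputable def numSpanningTrees {α β : Type*} (G : Graph α β) : ℕ :=
  G.spanningTrees.ncard

/-- The degree of a vertex: the number of edges at it, loops counted twice. -/
noncomputable def vertexDegree {α β : Type*} (G : Graph α β) (x : α) : ℕ :=
  (G.incidenceSet x).ncard + (G.loopSet x).ncard

/-- The adjacency matrix for a list `v` of vertices: entry `(i, j)` is the number of edges that
join `v i` and `v j`. -/
noncomputable def adjacencyMatrix {α β : Type*} (G : Graph α β) {n : ℕ}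
    (v : Fin n → α) : Matrix (Fin n) (Fin n) ℤ :=
  Matrix.of fun i j => (({e | G.IsLink e (v i) (v j)} : Set β).ncard : ℤ)

/-- The degree matrix minus the adjacency matrix. -/
noncomputable def laplacianMatrix {α β : Type*} (G : Graph α β) {n : ℕ}
    (v : Fin n → α) : Matrix (Fin n) (Fin n) ℤ :=
  Matrix.diagonal (fun i => (G.vertexDegree (v i) : ℤ)) - G.adjacencyMatrix v

/-- The Kirchhoff minor: the Laplacian with its last row and last column removed. -/
noncomputable def kirchhoffMinor {α β : Type*} (G : Graph α β) {n : ℕ}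
    (v : Fin (n + 1) → α) : Matrix (Fin n) (Fin n) ℤ :=
  (G.laplacianMatrix v).submatrix Fin.castSucc Fin.castSucc

end Graph

/-!
Expand `det K_Γ` row by row over the edges: a term chooses an edge `f i` for every vertex other than
the root, and vanishes unless `f i` is incident to that vertex. Such a choice sends each vertex
along its edge to a parent, and the term is `det (1 - P)`, where `P` is the matrix of the parent
relation. If every vertex is carried to the root, then `P` is strictly triangular along the parent
relation and the term is `1`; otherwise the indicator of the vertices that never reach the root is
fixed by `P` and the term is `0`. The choices of the first kind correspond to the spanning trees,
each oriented towards the root.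
-/

open Function Relation

open scoped Graph Matrix

namespace MatrixTree

section Determinant

variable {ι κ R : Type*} [Fintype ι] [DecidableEq ι] [CommRing R]

theorem det_sum_eq_sum_det_rows (s : Finset κ) (A : κ → Matrix ι ι R) :
    (∑ e ∈ s, A e).det =
      ∑ f ∈ Fintype.piFinset fun _ : ι => s, (Matrix.of fun i => A (f i) i).det := by
  classical
  have hrows : ∑ e ∈ s, A e = fun i => ∑ e ∈ s, A e i :=
    funext fun i => Finset.sum_apply i s A
  rw [hrows]
  exact (Matrix.detRowAlternating (R := R) (n := ι)).toMultilinearMap.map_sum_finset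
    (fun i e => A e i) fun _ => s

variable {r : ι → ι → Prop}

theorem det_one_sub_of_wellFounded (hr : WellFounded r) {N : Matrix ι ι R}
    (hN : ∀ i j, N i j ≠ 0 → r j i) : (1 - N).det = 1 := by
  have : IsWellFounded ι r := ⟨hr⟩
  let rank : ι → Ordinal := IsWellFounded.rank r
  have hzero {i j : ι} (hij : rank i ≤ rank j) : N i j = 0 := by
    by_contra hne
    exact (IsWellFounded.rank_lt_of_rel (hN i j hne)).not_ge hij
  have htri : (1 - N)ᵀ.BlockTriangular rank := fun i j hji => by
    have hne : j ≠ i := fun h => hji.ne (congrArg rank h)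
    simp [hne, hzero hji.le]
  rw [← Matrix.det_transpose, htri.det]
  refine Finset.prod_eq_one fun a _ => ?_
  have hblock : (1 - N)ᵀ.toSquareBlock rank a = 1 := by
    ext ⟨i, hi⟩ ⟨j, hj⟩
    simp [Matrix.toSquareBlock_def, Matrix.one_apply, hzero (hj.trans hi.symm).le]
  rw [hblock, Matrix.det_one]

open Classical in
theorem det_one_sub_of_not_wellFounded [IsDomain R] (hr : ¬ WellFounded r)
    (hr' : Relator.LeftUnique r) :
    (1 - Matrix.of fun i j => if r j i then (1 : R) else 0).det = 0 := by
  obtain ⟨a, ha⟩ : ∃ a, ¬ Acc r a := by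
    by_contra! hacc
    exact hr ⟨hacc⟩
  let u : ι → R := fun i => if Acc r i then 0 else 1
  have hfixed : (Matrix.of fun i j => if r j i then (1 : R) else 0).mulVec u = u := by
    ext i
    simp only [Matrix.mulVec, dotProduct, Matrix.of_apply, ite_mul, one_mul, zero_mul, u]
    by_cases hi : Acc r i
    · refine (Finset.sum_eq_zero fun j _ => ?_).trans (if_pos hi).symm
      split_ifs with hji hj
      exacts [rfl, absurd (hi.inv hji) hj, rfl]
    · obtain ⟨j, hj, hji⟩ := exists_not_acc_lt_of_not_acc hi
      rw [Finset.sum_eq_single j (fun k _ hkj => if_neg fun hki => hkj (hr' hki hji))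
        (by simp), if_pos hji, if_neg hj, if_neg hi]
  refine Matrix.exists_mulVec_eq_zero_iff.mp ⟨u, fun hu => ?_, ?_⟩
  · simpa [u, ha] using congrFun hu a
  · rw [Matrix.sub_mulVec, Matrix.one_mulVec, hfixed, sub_self]

end Determinant

section Cycles

variable {α β : Type*} {G T : Graph α β}

theorem injective_of_isLink_succ {k : ℕ} {x : Fin (k + 1) → α} {b : Fin k → β}
    (hx : Injective x) (hb : ∀ i, G.IsLink (b i) (x i.castSucc) (x i.succ)) : Injective b := by
  intro i j hij
  have hi := hb i
  rw [hij] at hi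
  rcases hi.eq_and_eq_or_eq_and_eq (hb j) with ⟨h, -⟩ | ⟨h, h'⟩
  · exact Fin.castSucc_injective _ (hx h)
  · have := Fin.ext_iff.mp (hx h)
    have := Fin.ext_iff.mp (hx h')
    simp only [Fin.val_castSucc, Fin.val_succ] at *
    omega

theorem isCycleOn_snoc {k : ℕ} {x : Fin (k + 1) → α} {b : Fin k → β} {e : β}
    (hx : Injective x) (hb : ∀ i, G.IsLink (b i) (x i.castSucc) (x i.succ))
    (he : G.IsLink e (x (Fin.last k)) (x 0)) (heb : e ∉ Set.range b) :
    G.IsCycleOn x (Fin.snoc b e : Fin (k + 1) → β) := by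
  refine ⟨hx, Fin.snoc_injective_iff.mpr ⟨injective_of_isLink_succ hx hb, heb⟩, fun i => ?_⟩
  induction i using Fin.lastCases with
  | last => simpa using he
  | cast i => simpa using hb i

theorem reachable_fromRel_of_reflTransGen {r : α → α → Prop} {x y : α}
    (h : ReflTransGen r x y) : (SimpleGraph.fromRel r).Reachable x y := by
  induction h with
  | refl => rfl
  | @tail b c _ hbc ih =>
    by_cases hne : b = c
    · exact hne ▸ ih
    · exact ih.trans (SimpleGraph.Adj.reachable ⟨hne, .inl hbc⟩)

theorem adj_of_fromRel_adj {x y : α} (h : (SimpleGraph.fromRel G.Adj).Adj x y) : G.Adj x y :=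
  h.2.elim id .symm

theorem exists_isCycleOn_of_isLink {F : Set β} {e : β} {x y : α} (he : G.IsLink e x y)
    (heF : e ∉ F) (h : ReflTransGen (G.restrict F).Adj x y) :
    ∃ (k : ℕ) (z : Fin (k + 1) → α) (b : Fin (k + 1) → β), G.IsCycleOn z b := by
  obtain ⟨w, hw⟩ := (reachable_fromRel_of_reflTransGen h).exists_isPath
  have hedge (i : Fin w.length) :
      ∃ b ∈ F, G.IsLink b (w.getVert i) (w.getVert (i + 1)) := by
    obtain ⟨b, hb⟩ := adj_of_fromRel_adj (w.adj_getVert_succ i.2)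
    exact ⟨b, hb.1, hb.2⟩
  choose b hbF hb using hedge
  let z : Fin (w.length + 1) → α := fun i => w.getVert i
  have hz : Injective z := fun i j hij =>
    Fin.ext (hw.getVert_injOn (Nat.le_of_lt_succ i.2) (Nat.le_of_lt_succ j.2) hij)
  refine ⟨w.length, z, Fin.snoc b e, isCycleOn_snoc hz hb (by simpa [z] using he.symm) ?_⟩
  rintro ⟨i, rfl⟩
  exact heF (hbF i)

theorem edgeSet_subset_of_isConnectedGraph_restrict (hT : T.IsTreeGraph) {F : Set β}
    (hF : (T.restrict F).IsConnectedGraph) : E(T) ⊆ F := by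
  intro e he
  by_contra heF
  obtain ⟨x, y, hxy⟩ := T.exists_isLink_of_mem_edgeSet he
  obtain ⟨k, z, b, hcycle⟩ :=
    exists_isCycleOn_of_isLink hxy heF (hF.2 x hxy.left_mem y hxy.right_mem)
  exact hT.2 k z b hcycle

end Cycles

section ParentEdges

variable {α β ι : Type*}

/-- If every listed vertex `v i` has chosen an edge `f i`, then `IsParent G v f j i` says that this
edge leads from `v i` to `v j`. The parent `j` is the first argument, so that well-foundedness means
that no vertex has an infinite line of ancestors. -/
def IsParent (G : Graph α β) (v : ι → α) (f : ι → β) (j i : ι) : Prop :=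
  G.IsLink (f i) (v i) (v j)

/-- A choice of an incident edge at each listed vertex (all vertices but the root) such that
following the chosen edges never goes on forever. These are the spanning trees oriented towards the
root: `f i` is the first edge on the way from `v i` to the root. -/
structure IsParentEdgeChoice (G : Graph α β) (v : ι → α) (f : ι → β) : Prop where
  inc : ∀ i, G.Inc (f i) (v i)
  wellFounded : WellFounded (IsParent G v f)

variable {G T : Graph α β} {v : ι → α} {f g : ι → β} {r : α}

theorem leftUnique_isParent (hv : Injective v) : Relator.LeftUnique (IsParent G v f) :=
  fun _ _ _ h h' => hv (h.right_unique h')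

namespace IsParentEdgeChoice

theorem mono (hTG : T ≤ G) (hf : IsParentEdgeChoice T v f) : IsParentEdgeChoice G v f where
  inc i := (hf.inc i).mono hTG
  wellFounded := hf.wellFounded.mono fun _ i h => (hTG.isLink_iff (hf.inc i).edge_mem).mpr h

theorem range_subset_edgeSet (hf : IsParentEdgeChoice G v f) : Set.range f ⊆ E(G) :=
  Set.range_subset_iff.mpr fun i => (hf.inc i).edge_mem

theorem reflTransGen_root (hf : IsParentEdgeChoice G v f) (hV : V(G) = insert r (Set.range v))
    {x : α} (hx : x ∈ V(G)) : ReflTransGen (G.restrict (Set.range f)).Adj x r := by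
  have hlisted (i : ι) : ReflTransGen (G.restrict (Set.range f)).Adj (v i) r := by
    induction i using hf.wellFounded.induction with
    | _ i ih =>
      obtain ⟨y, hy⟩ := hf.inc i
      refine .head ⟨f i, ⟨i, rfl⟩, hy⟩ ?_
      rcases hV ▸ hy.right_mem with rfl | ⟨j, rfl⟩
      exacts [.refl, ih j hy]
  rcases hV ▸ hx with rfl | ⟨i, rfl⟩
  exacts [.refl, hlisted i]

theorem isConnectedGraph_restrict (hf : IsParentEdgeChoice G v f)
    (hV : V(G) = insert r (Set.range v)) : (G.restrict (Set.range f)).IsConnectedGraph :=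
  ⟨⟨r, hV ▸ Set.mem_insert r _⟩, fun _ hx _ hy =>
    (hf.reflTransGen_root hV hx).trans (symm (hf.reflTransGen_root hV hy))⟩

/-- The edges of a cycle are chosen by distinct vertices of the cycle, hence by all of them, so the
cycle contains the parent of each of its vertices. -/
theorem not_isCycleOn_restrict (hf : IsParentEdgeChoice G v f) (hv : Injective v) {k : ℕ}
    (x : Fin (k + 1) → α) (e : Fin (k + 1) → β) :
    ¬ (G.restrict (Set.range f)).IsCycleOn x e := by
  rintro ⟨-, he, hlink⟩
  choose c hc using fun i => (hlink i).1
  have hends (i : Fin (k + 1)) {y : α} (hy : G.Inc (f (c i)) y) : ∃ l, x l = y := by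
    rw [hc] at hy
    rcases hy.eq_or_eq_of_isLink (hlink i).2 with h | h
    exacts [⟨_, h.symm⟩, ⟨_, h.symm⟩]
  choose l hl using fun i => hends i (hf.inc (c i))
  have hl_surj : Surjective l := Finite.surjective_of_injective fun i j hij => by
    have hcij : c i = c j := hv (by rw [← hl, ← hl, hij])
    exact he (by rw [← hc, ← hc, hcij])
  obtain ⟨_, ⟨i, rfl⟩, hmin⟩ := hf.wellFounded.has_min (Set.range c) (Set.range_nonempty c)
  obtain ⟨y, hy⟩ := hf.inc (c i)
  obtain ⟨m, rfl⟩ := hends i hy.inc_right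
  obtain ⟨j, rfl⟩ := hl_surj m
  rw [hl] at hy
  exact hmin (c j) ⟨j, rfl⟩ hy

theorem restrict_mem_spanningTrees (hf : IsParentEdgeChoice G v f) (hv : Injective v)
    (hV : V(G) = insert r (Set.range v)) : G.restrict (Set.range f) ∈ G.spanningTrees :=
  ⟨⟨Graph.restrict_le, rfl⟩, hf.isConnectedGraph_restrict hV,
    fun _ => hf.not_isCycleOn_restrict hv⟩

theorem eq_or_isParent_of_inc (hf : IsParentEdgeChoice G v f) (hv : Injective v) {i j : ι}
    (h : G.Inc (f i) (v j)) : i = j ∨ IsParent G v f j i := by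
  obtain ⟨y, hy⟩ := hf.inc i
  rcases h.eq_or_eq_of_isLink hy with hij | rfl
  exacts [.inl (hv hij.symm), .inr hy]

protected theorem injective (hf : IsParentEdgeChoice G v f) (hv : Injective v) : Injective f := by
  intro i j hij
  by_contra hne
  have hji := (hf.eq_or_isParent_of_inc hv (hij ▸ hf.inc j)).resolve_left hne
  have hij' := (hf.eq_or_isParent_of_inc hv (hij ▸ hf.inc i)).resolve_left (Ne.symm hne)
  exact hf.wellFounded.asymmetric _ _ hji hij'

theorem eq_of_range_subset (hf : IsParentEdgeChoice G v f) (hg : IsParentEdgeChoice G v g)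
    (hv : Injective v) (h : Set.range f ⊆ Set.range g) : f = g := by
  funext i
  induction i using hf.wellFounded.induction with
  | _ i ih =>
    obtain ⟨j, hj⟩ := h ⟨i, rfl⟩
    rcases hf.eq_or_isParent_of_inc hv (hj ▸ hg.inc j) with rfl | hparent
    · exact hj.symm
    · rw [hf.injective hv ((ih j hparent).trans hj)] at hj
      exact hj.symm

end IsParentEdgeChoice

theorem exists_adj_dist_lt {S : SimpleGraph α} {x y : α} (h : S.Reachable x y) (hne : x ≠ y) :
    ∃ z, S.Adj x z ∧ S.dist z y < S.dist x y := by
  obtain ⟨w, hw⟩ := h.exists_walk_length_eq_dist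
  cases w with
  | nil => exact absurd rfl hne
  | cons hadj w => exact ⟨_, hadj, hw ▸ Nat.lt_succ_of_le (SimpleGraph.dist_le w)⟩

theorem exists_isParentEdgeChoice_of_reflTransGen (hr : r ∉ Set.range v)
    (hreach : ∀ i, ReflTransGen G.Adj (v i) r) : ∃ f, IsParentEdgeChoice G v f := by
  let S := SimpleGraph.fromRel G.Adj
  have hcloser (i : ι) : ∃ e y, G.IsLink e (v i) y ∧ S.dist y r < S.dist (v i) r := by
    obtain ⟨y, hadj, hlt⟩ := exists_adj_dist_lt
      (reachable_fromRel_of_reflTransGen (hreach i)) fun h => hr ⟨i, h⟩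
    obtain ⟨e, he⟩ := adj_of_fromRel_adj hadj
    exact ⟨e, y, he, hlt⟩
  choose f y hf hlt using hcloser
  refine ⟨f, fun i => (hf i).inc_left, ?_⟩
  refine (measure fun i => S.dist (v i) r).wf.mono fun j i hji => ?_
  have hlt' := hlt i
  rwa [(hf i).right_unique hji] at hlt'

theorem exists_isParentEdgeChoice_restrict_eq (hT : T ∈ G.spanningTrees) (hr : r ∉ Set.range v)
    (hV : V(G) = insert r (Set.range v)) :
    ∃ f, IsParentEdgeChoice G v f ∧ G.restrict (Set.range f) = T := by
  obtain ⟨hTG, hT⟩ := hT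
  have hVT : V(T) = insert r (Set.range v) := hTG.vertexSet_eq.trans hV
  obtain ⟨f, hf⟩ := exists_isParentEdgeChoice_of_reflTransGen hr fun i =>
    hT.1.2 (v i) (hVT ▸ .inr ⟨i, rfl⟩) r (hVT ▸ .inl rfl)
  have hE : E(T) = Set.range f :=
    (edgeSet_subset_of_isConnectedGraph_restrict hT
      (hf.isConnectedGraph_restrict hVT)).antisymm hf.range_subset_edgeSet
  have hfG := hf.mono hTG.le
  refine ⟨f, hfG, (Graph.Compatible.of_le_le Graph.restrict_le hTG.le).ext
    hTG.vertexSet_eq.symm ?_⟩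
  rw [Graph.edgeSet_restrict, Set.inter_eq_right.mpr hfG.range_subset_edgeSet, hE]

theorem bijOn_isParentEdgeChoice_spanningTrees (hv : Injective v) (hr : r ∉ Set.range v)
    (hV : V(G) = insert r (Set.range v)) :
    Set.BijOn (fun f => G.restrict (Set.range f)) {f | IsParentEdgeChoice G v f}
      G.spanningTrees := by
  refine ⟨fun f hf => hf.restrict_mem_spanningTrees hv hV, fun f hf g hg hfg => ?_,
    fun T hT => exists_isParentEdgeChoice_restrict_eq hT hr hV⟩
  have hE : E(G) ∩ Set.range f = E(G) ∩ Set.range g := congrArg Graph.edgeSet hfg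
  rw [Set.inter_eq_right.mpr hf.range_subset_edgeSet,
    Set.inter_eq_right.mpr hg.range_subset_edgeSet] at hE
  exact hf.eq_of_range_subset hg hv hE.subset

end ParentEdges

section Laplacian

variable {α β ι : Type*} {G : Graph α β}

open Classical in
/-- The contribution of the single edge `e` to the rows and columns of the Laplacian that belong to
the vertices `v i`. -/
noncomputable def edgeLaplacian [DecidableEq ι] (G : Graph α β) (v : ι → α) (e : β) :
    Matrix ι ι ℤ :=
  Matrix.diagonal (fun i => if G.Inc e (v i) then 1 else 0) -
    Matrix.of fun i j => if G.IsLink e (v i) (v j) then 1 else 0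

theorem vertexDegree_eq_ncard_incidenceSet [G.Loopless] (x : α) :
    G.vertexDegree x = (G.incidenceSet x).ncard := by
  have hloop : G.loopSet x = ∅ := Set.eq_empty_of_forall_notMem fun e => G.not_isLoopAt e x
  rw [Graph.vertexDegree, hloop, Set.ncard_empty, add_zero]

open Classical in
theorem ncard_setOf_eq_sum_ite {R : Type*} [AddCommMonoidWithOne R] {s : Finset β}
    {P : β → Prop} (hP : ∀ e, P e → e ∈ s) :
    ({e | P e}.ncard : R) = ∑ e ∈ s, if P e then 1 else 0 := by
  rw [Finset.sum_boole, ← Set.ncard_coe_finset]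
  congr 2
  ext e
  simpa using hP e

theorem laplacianMatrix_eq_sum_edgeLaplacian [G.Loopless] (hE : E(G).Finite) {n : ℕ}
    (v : Fin n → α) : G.laplacianMatrix v = ∑ e ∈ hE.toFinset, edgeLaplacian G v e := by
  have hdegree (i : Fin n) := ncard_setOf_eq_sum_ite (R := ℤ) (s := hE.toFinset)
    (P := fun e => G.Inc e (v i)) fun _ h => hE.mem_toFinset.mpr h.edge_mem
  have hadjacency (i j : Fin n) := ncard_setOf_eq_sum_ite (R := ℤ) (s := hE.toFinset)
    (P := fun e => G.IsLink e (v i) (v j)) fun _ h => hE.mem_toFinset.mpr h.edge_mem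
  ext i j
  simp only [Graph.laplacianMatrix, Graph.adjacencyMatrix, edgeLaplacian, Matrix.sub_apply,
    Matrix.sum_apply, Matrix.of_apply, Finset.sum_sub_distrib, Matrix.diagonal_apply,
    vertexDegree_eq_ncard_incidenceSet, Graph.incidenceSet, hdegree, hadjacency]
  split_ifs <;> simp

open Classical in
theorem det_edgeLaplacian_rows [Fintype ι] [DecidableEq ι] {v : ι → α} (hv : Injective v)
    (f : ι → β) : (Matrix.of fun i => edgeLaplacian G v (f i) i).det =
      if IsParentEdgeChoice G v f then 1 else 0 := by
  by_cases hinc : ∀ i, G.Inc (f i) (v i)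
  · have hmatrix : (Matrix.of fun i => edgeLaplacian G v (f i) i) =
        1 - Matrix.of fun i j => if IsParent G v f j i then (1 : ℤ) else 0 := by
      ext i j
      simp only [edgeLaplacian, Matrix.of_apply, Matrix.sub_apply, Matrix.diagonal_apply,
        Matrix.one_apply, hinc, if_true]
      rfl
    rw [hmatrix]
    split_ifs with hf
    · exact det_one_sub_of_wellFounded hf.wellFounded fun i j => by simp
    · exact det_one_sub_of_not_wellFounded (fun hwf => hf ⟨hinc, hwf⟩) (leftUnique_isParent hv)
  · rw [if_neg fun hf => hinc hf.inc]
    obtain ⟨i, hi⟩ := not_forall.mp hinc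
    have hlink (j : ι) : ¬ G.IsLink (f i) (v i) (v j) := fun h => hi h.inc_left
    exact Matrix.det_eq_zero_of_row_eq_zero i fun j => by
      simp [edgeLaplacian, Matrix.diagonal_apply, hi, hlink]

theorem kirchhoffMinor_eq_laplacianMatrix {n : ℕ} (v : Fin (n + 1) → α) :
    G.kirchhoffMinor v = G.laplacianMatrix (Fin.init v) := by
  ext i j
  simp [Graph.kirchhoffMinor, Graph.laplacianMatrix, Graph.adjacencyMatrix, Matrix.diagonal_apply,
    Fin.init]

theorem numSpanningTrees_eq_det_laplacianMatrix [G.Loopless] (hE : E(G).Finite) {n : ℕ}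
    {v : Fin n → α} {r : α} (hv : Injective v) (hr : r ∉ Set.range v)
    (hV : V(G) = insert r (Set.range v)) :
    (G.numSpanningTrees : ℤ) = (G.laplacianMatrix v).det := by
  classical
  have hmem (f : Fin n → β) (hf : IsParentEdgeChoice G v f) :
      f ∈ Fintype.piFinset fun _ => hE.toFinset :=
    Fintype.mem_piFinset.mpr fun i => hE.mem_toFinset.mpr (hf.inc i).edge_mem
  calc (G.numSpanningTrees : ℤ)
      = {f | IsParentEdgeChoice G v f}.ncard := by
        rw [Graph.numSpanningTrees, (bijOn_isParentEdgeChoice_spanningTrees hv hr hV).ncard_eq]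
    _ = ∑ f ∈ Fintype.piFinset fun _ => hE.toFinset,
          if IsParentEdgeChoice G v f then 1 else 0 := ncard_setOf_eq_sum_ite hmem
    _ = ∑ f ∈ Fintype.piFinset fun _ => hE.toFinset,
          (Matrix.of fun i => edgeLaplacian G v (f i) i).det := by
        simp only [det_edgeLaplacian_rows hv]
    _ = (G.laplacianMatrix v).det := by
        rw [laplacianMatrix_eq_sum_edgeLaplacian hE, det_sum_eq_sum_det_rows]

end Laplacian

end MatrixTree

/-- `v` is an arbitrary numbering of the `n + 1` vertices of the loopless multigraph `G`. -/
theorem mainTheorem2 {α β : Type*} (G : Graph α β) (hE : G.edgeSet.Finite) (hG : G.Loopless)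
    (n : ℕ) (v : Fin (n + 1) ≃ G.vertexSet) :
    (G.numSpanningTrees : ℤ) = (G.kirchhoffMinor fun i => (v i : α)).det := by
  let w : Fin (n + 1) → α := Subtype.val ∘ v
  have hw : Injective w := Subtype.val_injective.comp v.injective
  have hroot : w (Fin.last n) ∉ Set.range (Fin.init w) := by
    rintro ⟨i, hi⟩
    exact (Fin.castSucc_lt_last i).ne (hw hi)
  have hV : V(G) = insert (w (Fin.last n)) (Set.range (Fin.init w)) := by
    rw [← Fin.range_snoc, Fin.snoc_init_self, v.surjective.range_comp, Subtype.range_coe]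
  calc (G.numSpanningTrees : ℤ)
      = (G.laplacianMatrix (Fin.init w)).det :=
        MatrixTree.numSpanningTrees_eq_det_laplacianMatrix hE
          (hw.comp (Fin.castSucc_injective n)) hroot hV
    _ = (G.kirchhoffMinor w).det := by rw [MatrixTree.kirchhoffMinor_eq_laplacianMatrix]
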